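/- Let $q\in[-1,1]$ and let $\mathcal H$ be a complex Hilbert space (scalar product linear in the second variable). On the tensor powers $\mathcal H^{\otimes n}$ ($\mathcal H^{\otimes 0}=\mathbb C$) let $\lambda_0=\lambda_1=\mathbf 1$, let $\lambda_2(f\otimes g)=f\otimes g+q\,g\otimes f$, and $\lambda_{n+2}=\mathbf 1_{\mathcal H}^{\otimes n}\otimes\lambda_2$ for $n\ge 1$. Let $\mathcal H_n$ be the Hilbert space obtained from $\mathcal H^{\otimes n}$ with the positive semidefinite form $\langle F,\lambda_nG\rangle_{\otimes n}$ by dividing out the kernel of the form and completing. The $(q,2)$-Fock space is the Hilbert space $\Gamma_{q,2}(\mathcal H)=\bigoplus_{n\ge 0}\mathcal H_n$, with vacuum vector $\Phi=1\oplus0\oplus0\oplus\cdots$. For $f\in\mathcal H$ let $A^+(f)$ be the bounded operator on $\Gamma_{q,2}(\mathcal H)$ with $A^+(f)\Phi=f$ and $A^+(f)F=f\otimes F$ for $F\in\mathcal H_n$, $n\ge1$; let $A(f)=(A^+(f))^*$, and put $A^{1}(f)=A^+(f)$, $A^{-1}(f)=A(f)$. For $n\ge1$ and $1\le k\le n$ let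 $\{-1,1\}^{2n}_{+,k}$ be the set of all $\varepsilon\in\{-1,1\}^{2n}$ such that $\sum_{h=1}^{2n}\varepsilon(h)=0$, $\sum_{h=p}^{2n}\varepsilon(h)\ge0$ for all $p\in\{1,\dots,2n\}$, and $\max\varepsilon^{-1}(\{-1\})=2n-k$. Fix $f\in\mathcal H$ with $\|f\|=1$ and let $$P_{n,k}=\sum_{\varepsilon\in\{-1,1\}^{2n}_{+,k}}\big\langle\Phi,A^{\varepsilon(1)}(f)\cdots A^{\varepsilon(2n)}(f)\Phi\big\rangle .$$ Then $$P_{n+1,k+1}=\sum_{h=k}^{n}P_{n,h}\qquad\text{for all } n\ge2 \text{ and } k\in\{2,\dots,n\},$$ $$P_{n+1,n+1}=P_{2,2}=1+q\qquad\text{for all } n\ge1.$$ Hence $x_{n,k}:=P_{n+1,k+1}$ ($n\ge1$, $1\le k\le n$) solves the Catalan's triangle system $$x_{n+1,k+1}=\sum_{j=k}^{n}x_{n,j}\qquad\text{for all } n\ge1 \text{ and } k\in\{1,\dots,n\},$$ with the boundary values $x_{n,n}=1+q$ for all $n\ge1$. -/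

import Mathlib

open scoped TensorProduct InnerProductSpace

namespace QTwoFock

noncomputable section

universe u

/-! ### The tensor powers of a Hilbert space -/

/-- The scalars `ℂ`, placed in the universe `u`. -/
abbrev Scalars : Type u := ULift.{u} ℂ

instance : InnerProductSpace ℂ Scalars.{u} where
  inner x y := inner ℂ x.down y.down
  norm_sq_eq_re_inner x := norm_sq_eq_re_inner (𝕜 := ℂ) x.down
  conj_inner_symm x y := inner_conj_symm (𝕜 := ℂ) x.down y.down
  add_left x y z := inner_add_left (𝕜 := ℂ) x.down y.down z.down
  smul_left x y c := inner_smul_left (𝕜 := ℂ) x.down y.down c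

/-- A complex pre-Hilbert space, bundled with its structure. -/
structure PreHilbert where
  carrier : Type u
  [group : NormedAddCommGroup carrier]
  [innerSpace : InnerProductSpace ℂ carrier]

variable (H : Type u) [NormedAddCommGroup H] [InnerProductSpace ℂ H]

/-- The algebraic tensor powers with their usual scalar product:
`H^{⊗0} = ℂ` and `H^{⊗(n+1)} = H ⊗ H^{⊗n}`. -/
def tensorPower : ℕ → PreHilbert.{u}
  | 0 => { carrier := Scalars.{u} }
  | n + 1 =>
    letI := (tensorPower n).group
    letI := (tensorPower n).innerSpace
    { carrier := H ⊗[ℂ] (tensorPower n).carrier }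

/-- `H^{⊗n}` as a type. -/
def TPow (n : ℕ) : Type u := (tensorPower H n).carrier

instance (n : ℕ) : NormedAddCommGroup (TPow H n) := (tensorPower H n).group

instance (n : ℕ) : InnerProductSpace ℂ (TPow H n) := (tensorPower H n).innerSpace

/-- The scalar `1 ∈ ℂ = H^{⊗0}`. -/
def scalarOne : TPow H 0 := (ULift.up 1 : Scalars.{u})

variable {H}

/-- The map `F ↦ f ⊗ F` from `H^{⊗n}` to `H^{⊗(n+1)}`. -/
def tensorLeft (f : H) (n : ℕ) : TPow H n →ₗ[ℂ] TPow H (n + 1) :=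
  TensorProduct.mk ℂ H (TPow H n) f

theorem ext_tensorLeft {M : Type*} [AddCommGroup M] [Module ℂ M] {n : ℕ}
    {a b : TPow H (n + 1) →ₗ[ℂ] M}
    (h : ∀ f, a ∘ₗ tensorLeft f n = b ∘ₗ tensorLeft f n) : a = b :=
  TensorProduct.ext' (M := H) (N := TPow H n) fun f F => LinearMap.congr_fun (h f) F

variable (H)

/-! ### The operators `λ_n` and the `n`-particle spaces -/

/-- The operators `λ_n` on `H^{⊗n}`: `λ_0` and `λ_1` are the identity,
`λ_2 (f ⊗ g) = f ⊗ g + q g ⊗ f`, and `λ_{n+1} = 1 ⊗ λ_n` for `n ≥ 2`. -/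
def lam (q : ℝ) : (n : ℕ) → TPow H n →ₗ[ℂ] TPow H n
  | 0 => LinearMap.id
  | 1 => LinearMap.id
  | 2 => LinearMap.id + (q : ℂ) • (TensorProduct.leftComm ℂ H H (TPow H 0)).toLinearMap
  | n + 3 => LinearMap.lTensor (N := TPow H (n + 2)) (P := TPow H (n + 2)) H (lam q (n + 2))

/-- The flip of the last two tensor factors, an isometry (auxiliary). -/
def flip : (n : ℕ) → TPow H (n + 2) →ₗᵢ[ℂ] TPow H (n + 2)
  | 0 => ((TensorProduct.assocIsometry ℂ H H (TPow H 0)).symm.trans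
      ((LinearIsometryEquiv.rTensor (TPow H 0) (TensorProduct.commIsometry ℂ H H)).trans
        (TensorProduct.assocIsometry ℂ H H (TPow H 0)))).toLinearIsometry
  | n + 1 => LinearIsometry.lTensor (F := TPow H (n + 2)) (G := TPow H (n + 2)) H (flip n)

theorem lam_two_tensorLeft (q : ℝ) (f g : H) (c : TPow H 0) :
    lam H q 2 (tensorLeft f 1 (tensorLeft g 0 c)) =
      tensorLeft f 1 (tensorLeft g 0 c) + (q : ℂ) • tensorLeft g 1 (tensorLeft f 0 c) := rfl

theorem lam_add_three_tensorLeft (q : ℝ) (f : H) (n : ℕ) (F : TPow H (n + 2)) :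
    lam H q (n + 3) (tensorLeft f (n + 2) F) = tensorLeft f (n + 2) (lam H q (n + 2) F) := rfl

theorem flip_zero_tensorLeft (f g : H) (c : TPow H 0) :
    flip H 0 (tensorLeft f 1 (tensorLeft g 0 c)) = tensorLeft g 1 (tensorLeft f 0 c) := rfl

theorem flip_succ_tensorLeft (f : H) (n : ℕ) (F : TPow H (n + 2)) :
    flip H (n + 1) (tensorLeft f (n + 2) F) = tensorLeft f (n + 2) (flip H n F) := rfl

theorem lam_eq (q : ℝ) (n : ℕ) :
    lam H q (n + 2) = LinearMap.id + (q : ℂ) • (flip H n).toLinearMap := by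
  induction n with
  | zero => exact ext_tensorLeft fun f => ext_tensorLeft fun g => rfl
  | succ n ih =>
    refine ext_tensorLeft fun f => LinearMap.ext fun F => ?_
    change lam H q (n + 3) (tensorLeft f (n + 2) F) =
      tensorLeft f (n + 2) F + (q : ℂ) • flip H (n + 1) (tensorLeft f (n + 2) F)
    rw [lam_add_three_tensorLeft, ih, flip_succ_tensorLeft]
    simp

theorem flip_comp_flip (n : ℕ) :
    (flip H n).toLinearMap ∘ₗ (flip H n).toLinearMap = LinearMap.id := by
  induction n with
  | zero => exact ext_tensorLeft fun f => ext_tensorLeft fun g => rfl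
  | succ n ih =>
    refine ext_tensorLeft fun f => LinearMap.ext fun F => ?_
    change flip H (n + 1) (flip H (n + 1) (tensorLeft f (n + 2) F)) = tensorLeft f (n + 2) F
    rw [flip_succ_tensorLeft, flip_succ_tensorLeft]
    exact congrArg _ (LinearMap.congr_fun ih F)

theorem flip_flip (n : ℕ) (x : TPow H (n + 2)) : flip H n (flip H n x) = x :=
  LinearMap.congr_fun (flip_comp_flip H n) x

theorem inner_flip (n : ℕ) (x y : TPow H (n + 2)) :
    inner ℂ (flip H n x) y = inner ℂ x (flip H n y) := by
  conv_lhs => rw [← flip_flip H n y]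
  exact (flip H n).inner_map_map x (flip H n y)

/-- `λ_n` is symmetric. -/
theorem inner_lam (q : ℝ) (n : ℕ) (x y : TPow H n) :
    inner ℂ (lam H q n x) y = inner ℂ x (lam H q n y) := by
  match n, x, y with
  | 0, x, y => rfl
  | 1, x, y => rfl
  | n + 2, x, y =>
    rw [lam_eq]
    simp only [LinearMap.add_apply, LinearMap.id_apply, LinearMap.smul_apply,
      LinearIsometry.coe_toLinearMap, inner_add_left, inner_add_right, inner_smul_left,
      inner_smul_right, inner_flip, Complex.conj_ofReal]

/-- `λ_n` is positive. -/
theorem re_inner_lam_nonneg (q : Set.Icc (-1 : ℝ) 1) (n : ℕ) (x : TPow H n) :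
    0 ≤ RCLike.re (inner ℂ x (lam H q n x)) := by
  match n, x with
  | 0, x => exact inner_self_nonneg (𝕜 := ℂ) (x := x)
  | 1, x => exact inner_self_nonneg (𝕜 := ℂ) (x := x)
  | n + 2, x =>
    rw [lam_eq]
    simp only [LinearMap.add_apply, LinearMap.id_apply, LinearMap.smul_apply,
      LinearIsometry.coe_toLinearMap, inner_add_right, inner_smul_right, map_add]
    have h1 : RCLike.re (inner ℂ x x) = ‖x‖ ^ 2 := (norm_sq_eq_re_inner (𝕜 := ℂ) x).symm
    have h2 : |(inner ℂ x (flip H n x)).re| ≤ ‖x‖ ^ 2 := by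
      refine (Complex.abs_re_le_norm _).trans ((norm_inner_le_norm _ _).trans ?_)
      rw [(flip H n).norm_map, sq]
    have h3 : |(q : ℝ)| ≤ 1 := abs_le.2 q.2
    have h4 : |(q : ℝ) * (inner ℂ x (flip H n x)).re| ≤ ‖x‖ ^ 2 := by
      rw [abs_mul]
      nlinarith [abs_nonneg (q : ℝ), abs_nonneg (inner ℂ x (flip H n x)).re]
    rw [h1]
    have h5 : RCLike.re (((q : ℝ) : ℂ) * inner ℂ x (flip H n x))
        = (q : ℝ) * (inner ℂ x (flip H n x)).re := by
      simp
    rw [h5]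
    linarith [neg_abs_le ((q : ℝ) * (inner ℂ x (flip H n x)).re)]

variable (q : Set.Icc (-1 : ℝ) 1)

/-- `H^{⊗n}`, to be equipped with the form `⟨F, λ_n G⟩`. -/
def QPow (_q : Set.Icc (-1 : ℝ) 1) (n : ℕ) : Type u := TPow H n

instance (n : ℕ) : AddCommGroup (QPow H q n) := inferInstanceAs (AddCommGroup (TPow H n))

instance (n : ℕ) : Module ℂ (QPow H q n) := inferInstanceAs (Module ℂ (TPow H n))

/-- The identity map from `H^{⊗n}` to its copy `QPow H q n`. -/
def toQPow (n : ℕ) : TPow H n ≃ₗ[ℂ] QPow H q n := LinearEquiv.refl ℂ (TPow H n)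

/-- The positive semidefinite form `⟨F, G⟩_n = ⟨F, λ_n G⟩` on `H^{⊗n}`. -/
@[reducible] def qCore (n : ℕ) : PreInnerProductSpace.Core ℂ (QPow H q n) where
  inner F G := inner ℂ (E := TPow H n) F (lam H q n G)
  conj_inner_symm F G := (inner_conj_symm (𝕜 := ℂ) _ _).trans (inner_lam H q n F G)
  re_inner_nonneg F := re_inner_lam_nonneg H q n F
  add_left F G _ := inner_add_left (E := TPow H n) F G _
  smul_left F _ c := inner_smul_left (E := TPow H n) F _ c

instance (n : ℕ) : SeminormedAddCommGroup (QPow H q n) :=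
  letI := qCore H q n
  InnerProductSpace.Core.toSeminormedAddCommGroup (𝕜 := ℂ)

instance (n : ℕ) : InnerProductSpace ℂ (QPow H q n) := InnerProductSpace.ofCore (qCore H q n)

theorem inner_toQPow (n : ℕ) (F G : TPow H n) :
    inner ℂ (toQPow H q n F) (toQPow H q n G) = inner ℂ F (lam H q n G) := rfl

/-- The `n`-particle space `H_n`: the Hausdorff completion of `H^{⊗n}` for the form
`⟨F, λ_n G⟩`, that is, the completion of the quotient by the kernel of this form. -/
abbrev Particle (n : ℕ) : Type u := UniformSpace.Completion (QPow H q n)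

/-- The `(q,2)`-Fock space: the Hilbert space direct sum of the `n`-particle spaces. -/
abbrev Fock : Type u := lp (Particle H q) 2

/-- The vacuum vector `Φ = 1 ⊕ 0 ⊕ 0 ⊕ ⋯`. -/
def vacuum : Fock H q :=
  lp.single 2 0 (toQPow H q 0 (scalarOne H) : Particle H q 0)

/-! ### Creation and annihilation operators -/

variable {H}

theorem inner_tensorLeft (f g : H) (n : ℕ) (F G : TPow H n) :
    inner ℂ (tensorLeft f n F) (tensorLeft g n G) = inner ℂ f g * inner ℂ F G :=
  TensorProduct.inner_tmul (𝕜 := ℂ) (E := H) (F := TPow H n) f g F G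

theorem norm_tensorLeft (f : H) (n : ℕ) (F : TPow H n) : ‖tensorLeft f n F‖ = ‖f‖ * ‖F‖ :=
  TensorProduct.norm_tmul (𝕜 := ℂ) (E := H) (F := TPow H n) f F

theorem norm_sq_toQPow (n : ℕ) (F : TPow H n) :
    ‖toQPow H q n F‖ ^ 2 = RCLike.re (inner ℂ F (lam H q n F)) :=
  norm_sq_eq_re_inner (𝕜 := ℂ) (toQPow H q n F)

theorem norm_sq_toQPow_zero (F : TPow H 0) : ‖toQPow H q 0 F‖ ^ 2 = ‖F‖ ^ 2 :=
  (norm_sq_toQPow q 0 F).trans (norm_sq_eq_re_inner (𝕜 := ℂ) F).symm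

theorem norm_sq_toQPow_one (F : TPow H 1) : ‖toQPow H q 1 F‖ ^ 2 = ‖F‖ ^ 2 :=
  (norm_sq_toQPow q 1 F).trans (norm_sq_eq_re_inner (𝕜 := ℂ) F).symm

theorem norm_sq_toQPow_le (n : ℕ) (F : TPow H n) : ‖toQPow H q n F‖ ^ 2 ≤ 2 * ‖F‖ ^ 2 := by
  match n, F with
  | 0, F => rw [norm_sq_toQPow_zero]; nlinarith [sq_nonneg ‖F‖]
  | 1, F => rw [norm_sq_toQPow_one]; nlinarith [sq_nonneg ‖F‖]
  | n + 2, F =>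
    have h3 : |(q : ℝ)| ≤ 1 := abs_le.2 q.2
    have h1 : ‖lam H q (n + 2) F‖ ≤ 2 * ‖F‖ := by
      rw [lam_eq]
      refine (norm_add_le _ _).trans ?_
      change ‖F‖ + ‖((q : ℝ) : ℂ) • flip H n F‖ ≤ _
      rw [norm_smul, (flip H n).norm_map, Complex.norm_real, Real.norm_eq_abs]
      nlinarith [norm_nonneg F]
    rw [norm_sq_toQPow]
    refine (re_inner_le_norm (𝕜 := ℂ) F (lam H q (n + 2) F)).trans ?_
    nlinarith [norm_nonneg F]

/-- Left tensoring by `f` is bounded for the seminorms of `⟨·, λ_n ·⟩`. -/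
theorem norm_toQPow_tensorLeft_le (f : H) (n : ℕ) (F : TPow H n) :
    ‖toQPow H q (n + 1) (tensorLeft f n F)‖ ≤ (2 * ‖f‖) * ‖toQPow H q n F‖ := by
  refine le_of_sq_le_sq ?_ (by positivity)
  have key : ∀ m : ℕ, ∀ F : TPow H m, ‖toQPow H q m F‖ ^ 2 = ‖F‖ ^ 2 →
      ‖toQPow H q (m + 1) (tensorLeft f m F)‖ ^ 2 ≤ ((2 * ‖f‖) * ‖toQPow H q m F‖) ^ 2 := by
    intro m F hF
    refine (norm_sq_toQPow_le q (m + 1) _).trans ?_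
    rw [mul_pow, hF, norm_tensorLeft]
    nlinarith [sq_nonneg (‖f‖ * ‖F‖)]
  match n, F with
  | 0, F => exact key 0 F (norm_sq_toQPow_zero q F)
  | 1, F => exact key 1 F (norm_sq_toQPow_one q F)
  | n + 2, F =>
    have h : ‖toQPow H q (n + 2 + 1) (tensorLeft f (n + 2) F)‖ ^ 2 =
        ‖f‖ ^ 2 * ‖toQPow H q (n + 2) F‖ ^ 2 := by
      rw [norm_sq_toQPow, norm_sq_toQPow, lam_add_three_tensorLeft, inner_tensorLeft,
        inner_self_eq_norm_sq_to_K]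
      norm_cast
      exact RCLike.re_ofReal_mul (K := ℂ) _ _
    rw [h]
    nlinarith [sq_nonneg (‖f‖ * ‖toQPow H q (n + 2) F‖)]

/-- `F ↦ f ⊗ F` as a bounded operator for the seminorms of `⟨·, λ_n ·⟩`. -/
def creationQPow (f : H) (n : ℕ) : QPow H q n →L[ℂ] QPow H q (n + 1) :=
  LinearMap.mkContinuous
    ((toQPow H q (n + 1)).toLinearMap ∘ₗ tensorLeft f n ∘ₗ (toQPow H q n).symm.toLinearMap)
    (2 * ‖f‖) (fun F => norm_toQPow_tensorLeft_le q f n ((toQPow H q n).symm F))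

theorem creationQPow_toQPow (f : H) (n : ℕ) (F : TPow H n) :
    creationQPow q f n (toQPow H q n F) = toQPow H q (n + 1) (tensorLeft f n F) := rfl

/-- The operator `F ↦ f ⊗ F` from `H_n` to `H_{n+1}`. -/
def creationParticle (f : H) (n : ℕ) : Particle H q n →L[ℂ] Particle H q (n + 1) :=
  (creationQPow q f n).completion

theorem norm_creationParticle_le (f : H) (n : ℕ) (F : Particle H q n) :
    ‖creationParticle q f n F‖ ≤ (2 * ‖f‖) * ‖F‖ := by
  induction F using UniformSpace.Completion.induction_on with
  | hp => exact isClosed_le (by fun_prop) (by fun_prop)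
  | ih F =>
    have h : creationParticle q f n (F : Particle H q n) =
        ((creationQPow q f n F : QPow H q (n + 1)) : Particle H q (n + 1)) :=
      ContinuousLinearMap.completion_apply_coe _ F
    rw [h, UniformSpace.Completion.norm_coe, UniformSpace.Completion.norm_coe]
    exact norm_toQPow_tensorLeft_le q f n ((toQPow H q n).symm F)

/-- The components of `A⁺(f) F`: degree `0` is zero, degree `n + 1` is `f ⊗ F_n`. -/
def creationFun (f : H) (F : Fock H q) : (n : ℕ) → Particle H q n
  | 0 => 0
  | n + 1 => creationParticle q f n (F n)

theorem sum_creationFun_le (f : H) (F : Fock H q) (s : Finset ℕ) :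
    ∑ n ∈ s, ‖creationFun q f F n‖ ^ (2 : ENNReal).toReal ≤
      ((2 * ‖f‖) * ‖F‖) ^ (2 : ENNReal).toReal := by
  have h2 : (2 : ENNReal).toReal = (2 : ℕ) := by norm_num
  have hF := lp.hasSum_norm (p := 2) (by norm_num) F
  simp only [h2, Real.rpow_natCast] at hF ⊢
  have hS : HasSum (fun n => (2 * ‖f‖) ^ 2 * ‖F n‖ ^ 2) ((2 * ‖f‖) ^ 2 * ‖F‖ ^ 2) :=
    hF.mul_left _
  have hle : ∀ n, ‖creationFun q f F (n + 1)‖ ^ 2 ≤ (2 * ‖f‖) ^ 2 * ‖F n‖ ^ 2 := by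
    intro n
    rw [← mul_pow]
    exact pow_le_pow_left₀ (norm_nonneg _) (norm_creationParticle_le q f n (F n)) 2
  have hsum : Summable fun n => ‖creationFun q f F (n + 1)‖ ^ 2 :=
    Summable.of_nonneg_of_le (fun n => by positivity) hle hS.summable
  have hsum' : Summable fun n => ‖creationFun q f F n‖ ^ 2 := (summable_nat_add_iff 1).1 hsum
  refine (hsum'.sum_le_tsum s fun n _ => by positivity).trans ?_
  rw [hsum'.tsum_eq_zero_add, mul_pow]
  have h0 : ‖creationFun q f F 0‖ ^ 2 = 0 := by
    change ‖(0 : Particle H q 0)‖ ^ 2 = 0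
    simp
  rw [h0, zero_add, ← hS.tsum_eq]
  exact hsum.tsum_le_tsum hle hS.summable

/-- The creation operator `A⁺(f)` on the `(q,2)`-Fock space: the bounded linear operator with
`A⁺(f) Φ = f` and `A⁺(f) F = f ⊗ F`. -/
def creation (f : H) : Fock H q →L[ℂ] Fock H q :=
  LinearMap.mkContinuous (σ := RingHom.id ℂ)
    { toFun := fun F => (⟨creationFun q f F, memℓp_gen' (sum_creationFun_le q f F)⟩ : Fock H q)
      map_add' := fun F G => by
        ext n
        cases n with
        | zero => exact (add_zero (0 : Particle H q 0)).symm
        | succ n => exact map_add (creationParticle q f n) (F n) (G n)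
      map_smul' := fun c F => by
        ext n
        cases n with
        | zero => exact (smul_zero c).symm
        | succ n => exact map_smul (creationParticle q f n) c (F n) }
    (2 * ‖f‖)
    (fun F => lp.norm_le_of_forall_sum_le (by norm_num) (by positivity)
      (sum_creationFun_le q f F))

/-- The annihilation operator `A(f) = (A⁺(f))*`. -/
def annihilation (f : H) : Fock H q →L[ℂ] Fock H q :=
  ContinuousLinearMap.adjoint (creation q f)

/-- `A^ε(f)` for a sign `ε ∈ {-1, 1}`: `A⁺(f)` if `ε = 1` and `A(f)` if `ε = -1`. -/
def opSign (ε : ℤˣ) (f : H) : Fock H q →L[ℂ] Fock H q :=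
  if ε = 1 then creation q f else annihilation q f

/-- The vacuum mixed moment `⟨Φ, A^{ε(1)}(f_1) ⋯ A^{ε(m)}(f_m) Φ⟩`. -/
def vacuumMoment {m : ℕ} (ε : Fin m → ℤˣ) (f : Fin m → H) : ℂ :=
  inner ℂ (vacuum H q) ((List.ofFn fun i => opSign q (ε i) (f i)).prod (vacuum H q))

/-! ### Sign sequences and the numbers `P_{n,k}` -/

/-- `{-1,1}^{2n}_+`: the sign sequences with total sum `0` all of whose tail sums
are nonnegative. (The position `p ∈ {1, …, 2n}` is the index `p - 1` of `Fin (2 * n)`.) -/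
def signPlus (n : ℕ) : Set (Fin (2 * n) → ℤˣ) :=
  {ε | ∑ i, (ε i : ℤ) = 0 ∧ ∀ p, 0 ≤ ∑ i ∈ Finset.Ici p, (ε i : ℤ)}

/-- `{-1,1}^{2n}_{+,k}`: the sequences in `{-1,1}^{2n}_+` whose last `-1`
(that is, last annihilator) is at the position `2n - k`. -/
def signPlusLast (n k : ℕ) : Set (Fin (2 * n) → ℤˣ) :=
  {ε ∈ signPlus n | ∃ i : Fin (2 * n), (i : ℕ) + 1 + k = 2 * n ∧ IsGreatest {j | ε j = -1} i}

open Classical in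
/-- `P_{n,k} = ∑_{ε ∈ {-1,1}^{2n}_{+,k}} ⟨Φ, A^{ε(1)}(f) ⋯ A^{ε(2n)}(f) Φ⟩`. -/
def P (f : H) (n k : ℕ) : ℂ :=
  ∑ ε : Fin (2 * n) → ℤˣ with ε ∈ signPlusLast n k, vacuumMoment q ε (fun _ => f)

end

/-- The Catalan's triangle system for a family `(x_{n,k})`, `n ≥ 1`, `1 ≤ k ≤ n`. -/
def IsCatalanTriangleSolution (x : ℕ → ℕ → ℂ) : Prop :=
  ∀ n k : ℕ, 1 ≤ k → k ≤ n → x (n + 1) (k + 1) = ∑ j ∈ Finset.Icc k n, x n j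

end QTwoFock

open scoped InnerProductSpace

namespace QTwoFock

noncomputable section

universe u

variable {H : Type u} [NormedAddCommGroup H] [InnerProductSpace ℂ H]

/-! Everything takes place on the lines spanned by the vectors f^{⊗n}. Creation raises n by one;
annihilation lowers it with weight w(n), where w(2) = 1 + q and w(n) = 1 for every other n ≥ 1, and
it kills the vacuum. A sign sequence, read from right to left, is thus a lattice path whose height
is the tail sum, and its moment is the product of the weights of its down steps if the path stays
nonnegative and ends at 0, and 0 otherwise.

Since bad sequences contribute nothing, the positivity constraint in P_{n,k} can be dropped
(`P_eq_inner_lastNegSum`). Then only the initial ascent to height k and the first descent are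
prescribed, and all later letters are free, so they sum to a power of A⁺ + A. Hence P_{n,k+1} =
w(k+1) S(2n-k-2, k), where S(m, j) is the weighted count of paths from height j to 0 in m steps
(`P_eq_pathSum`).

Conditioning on the first step gives S(m+1, k+1) = S(m, k+2) + w(k+1) S(m, k), and the last term is
again some P_{n,k+1}. Iterating yields S(2n-k, k) = ∑_{h=k}^n P_{n,h} (`pathSum_eq_sum_P`). The left
side is P_{n+1,k+1} when w(k+1) = 1, which is where k ≥ 2 enters. -/

/-- The tensor power `f^{⊗n}`. -/
def tensorPow (f : H) : (n : ℕ) → TPow H n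
  | 0 => scalarOne H
  | n + 1 => tensorLeft f n (tensorPow f n)

/-- The vector `f^{⊗n}` of the Fock space. -/
def fockPow (q : Set.Icc (-1 : ℝ) 1) (f : H) (n : ℕ) : Fock H q :=
  lp.single 2 n (toQPow H q n (tensorPow f n) : Particle H q n)

/-- The weight of a step down from height `n`. -/
def downWeight (q : ℝ) (n : ℕ) : ℂ := if n = 2 then 1 + (q : ℂ) else 1

variable (q : Set.Icc (-1 : ℝ) 1)

/-! ### Creation and annihilation on the powers of f. -/

theorem creation_fockPow (f : H) (n : ℕ) :
    creation q f (fockPow q f n) = fockPow q f (n + 1) := by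
  ext m
  cases m with
  | zero =>
    refine Eq.trans (b := (0 : Particle H q 0)) rfl ?_
    rw [fockPow, lp.coeFn_single, Pi.single_eq_of_ne (by omega)]
  | succ m =>
    change creationParticle q f m (fockPow q f n m) = _
    by_cases h : m = n
    · subst h
      rw [fockPow, fockPow, lp.coeFn_single, lp.coeFn_single, Pi.single_eq_same,
        Pi.single_eq_same]
      exact ContinuousLinearMap.completion_apply_coe _ _
    · rw [fockPow, fockPow, lp.coeFn_single, lp.coeFn_single, Pi.single_eq_of_ne h,
        Pi.single_eq_of_ne (by omega), map_zero]

/-- Source of the weights: from degree 3 on, the form operator leaves the first factor alone, so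
only ⟨f, f⟩ = 1 comes out. In degree 2 the flip fixes f ⊗ f, which gives 1 + q. -/
theorem inner_tensorLeft_lam_tensorPow {f : H} (hf : ‖f‖ = 1) (n : ℕ) (F : TPow H n) :
    inner ℂ (tensorLeft f n F) (lam H q (n + 1) (tensorPow f (n + 1))) =
      downWeight q (n + 1) * inner ℂ F (lam H q n (tensorPow f n)) := by
  have hff : inner ℂ f f = (1 : ℂ) := by simp [inner_self_eq_norm_sq_to_K, hf]
  match n, F with
  | 0, F =>
    change inner ℂ (tensorLeft f 0 F) (tensorLeft f 0 (tensorPow f 0)) =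
      _ * inner ℂ F (tensorPow f 0)
    rw [inner_tensorLeft, hff]
    simp [downWeight]
  | 1, F =>
    change inner ℂ (tensorLeft f 1 F)
      (tensorLeft f 1 (tensorPow f 1) + ((q : ℝ) : ℂ) • tensorLeft f 1 (tensorPow f 1)) =
      _ * inner ℂ F (tensorPow f 1)
    rw [inner_add_right, inner_smul_right, inner_tensorLeft, hff]
    simp [downWeight]
    ring
  | n + 2, F =>
    change inner ℂ (tensorLeft f (n + 2) F)
      (tensorLeft f (n + 2) (lam H q (n + 2) (tensorPow f (n + 2)))) = _
    rw [inner_tensorLeft, hff]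
    simp [downWeight]

theorem inner_creationParticle_tensorPow {f : H} (hf : ‖f‖ = 1) (n : ℕ) (F : Particle H q n) :
    inner ℂ (creationParticle q f n F)
        (toQPow H q (n + 1) (tensorPow f (n + 1)) : Particle H q (n + 1)) =
      downWeight q (n + 1) * inner ℂ F (toQPow H q n (tensorPow f n) : Particle H q n) := by
  induction F using UniformSpace.Completion.induction_on with
  | hp => exact isClosed_eq (by fun_prop) (by fun_prop)
  | ih F =>
    have h : creationParticle q f n (F : Particle H q n) =
        ((creationQPow q f n F : QPow H q (n + 1)) : Particle H q (n + 1)) :=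
      ContinuousLinearMap.completion_apply_coe _ F
    rw [h, UniformSpace.Completion.inner_coe, UniformSpace.Completion.inner_coe]
    exact inner_tensorLeft_lam_tensorPow q hf n ((toQPow H q n).symm F)

theorem annihilation_fockPow_succ {f : H} (hf : ‖f‖ = 1) (n : ℕ) :
    annihilation q f (fockPow q f (n + 1)) = downWeight q (n + 1) • fockPow q f n := by
  refine ext_inner_left ℂ fun G => ?_
  rw [annihilation, ContinuousLinearMap.adjoint_inner_right, inner_smul_right, fockPow, fockPow,
    lp.inner_single_right, lp.inner_single_right]
  exact inner_creationParticle_tensorPow q hf n (G n)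

theorem annihilation_fockPow_zero (f : H) : annihilation q f (fockPow q f 0) = 0 := by
  refine ext_inner_left ℂ fun G => ?_
  rw [annihilation, ContinuousLinearMap.adjoint_inner_right, fockPow, lp.inner_single_right,
    inner_zero_right]
  exact inner_zero_left _

theorem inner_vacuum_fockPow (f : H) (n : ℕ) :
    inner ℂ (vacuum H q) (fockPow q f n) = if n = 0 then 1 else 0 := by
  rw [vacuum, lp.inner_single_left]
  split_ifs with h
  · subst h
    rw [fockPow, lp.coeFn_single, Pi.single_eq_same, UniformSpace.Completion.inner_coe]
    change inner ℂ (1 : ℂ) (1 : ℂ) = 1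
    simp
  · rw [fockPow, lp.coeFn_single, Pi.single_eq_of_ne (Ne.symm h), inner_zero_right]

/-! ### Vectors obtained from sign sequences -/

/-- The vector `A^{ε(1)}(f) ⋯ A^{ε(m)}(f) Φ`. -/
def signVector (f : H) {m : ℕ} (ε : Fin m → ℤˣ) : Fock H q :=
  (List.ofFn fun i => opSign q (ε i) f).prod (vacuum H q)

theorem signVector_cons (f : H) {m : ℕ} (s : ℤˣ) (ε : Fin m → ℤˣ) :
    signVector q f (Fin.cons s ε : Fin (m + 1) → ℤˣ) = opSign q s f (signVector q f ε) := by
  simp [signVector, List.ofFn_succ]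

theorem signVector_const_one (f : H) (m : ℕ) :
    signVector q f (fun _ : Fin m => 1) = fockPow q f m := by
  induction m with
  | zero => rfl
  | succ m ih =>
    have h : (fun _ : Fin (m + 1) => (1 : ℤˣ)) = Fin.cons 1 (fun _ : Fin m => 1) := by
      ext i; cases i using Fin.cases <;> simp
    rw [h, signVector_cons, ih, opSign, if_pos rfl, creation_fockPow]

theorem sum_Ici_succ_cons {m : ℕ} (s : ℤˣ) (ε : Fin m → ℤˣ) (p : Fin m) :
    ∑ i ∈ Finset.Ici p.succ, ((Fin.cons s ε : Fin (m + 1) → ℤˣ) i : ℤ) =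
      ∑ i ∈ Finset.Ici p, (ε i : ℤ) := by
  rw [← Fin.map_succEmb_Ici, Finset.sum_map]
  simp

/-- Induction on the leftmost letter, the operator applied last. The total sum is the height
reached; a first negative tail sum means that an annihilator has met a multiple of the vacuum. -/
theorem signVector_eq {f : H} (hf : ‖f‖ = 1) {m : ℕ} (ε : Fin m → ℤˣ) :
    ((∀ p, 0 ≤ ∑ i ∈ Finset.Ici p, (ε i : ℤ)) →
      ∃ (c : ℂ) (j : ℕ), ∑ i, (ε i : ℤ) = j ∧ signVector q f ε = c • fockPow q f j) ∧
    ((∃ p, ∑ i ∈ Finset.Ici p, (ε i : ℤ) < 0) → signVector q f ε = 0) := by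
  induction m with
  | zero =>
    exact ⟨fun _ => ⟨1, 0, by simp, (one_smul ℂ _).symm⟩, fun ⟨p, _⟩ => p.elim0⟩
  | succ m ih =>
    obtain ⟨s, ε, rfl⟩ : ∃ (s : ℤˣ) (δ : Fin m → ℤˣ), ε = Fin.cons s δ :=
      ⟨ε 0, Fin.tail ε, (Fin.cons_self_tail ε).symm⟩
    obtain ⟨ih1, ih2⟩ := ih ε
    have h0 : ∑ i ∈ Finset.Ici (0 : Fin (m + 1)), ((Fin.cons s ε : Fin (m + 1) → ℤˣ) i : ℤ) =
        s + ∑ i, (ε i : ℤ) := by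
      have : Finset.Ici (0 : Fin (m + 1)) = Finset.univ := Finset.Ici_bot
      rw [this, Fin.sum_univ_succ]
      simp
    have hsum : ∑ i, ((Fin.cons s ε : Fin (m + 1) → ℤˣ) i : ℤ) = s + ∑ i, (ε i : ℤ) := by
      rw [Fin.sum_univ_succ]
      simp
    rw [signVector_cons]
    constructor
    · intro h
      obtain ⟨c, j, hj, hv⟩ := ih1 fun p => by
        have := h p.succ
        rwa [sum_Ici_succ_cons] at this
      have hs := h 0
      rw [h0, hj] at hs
      rw [hsum, hj, hv]
      rcases Int.units_eq_one_or s with rfl | rfl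
      · refine ⟨c, j + 1, by push_cast; ring, ?_⟩
        rw [opSign, if_pos rfl, map_smul, creation_fockPow]
      · obtain _ | j := j
        · simp at hs
        · refine ⟨c * downWeight q (j + 1), j, by push_cast; ring, ?_⟩
          rw [opSign, if_neg (by decide), map_smul, annihilation_fockPow_succ q hf, smul_smul]
    · rintro ⟨p, hp⟩
      by_cases hε : ∃ p, ∑ i ∈ Finset.Ici p, (ε i : ℤ) < 0
      · rw [ih2 hε, map_zero]
      · push Not at hε
        obtain ⟨c, j, hj, hv⟩ := ih1 hε
        cases p using Fin.cases with
        | succ p =>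
          rw [sum_Ici_succ_cons] at hp
          exact absurd hp (hε p).not_gt
        | zero =>
          rw [h0, hj] at hp
          rcases Int.units_eq_one_or s with rfl | rfl
          · rw [Units.val_one] at hp
            omega
          -- The remaining letters reach height j ≥ 0 and one down step makes it negative, so the
          -- height was 0.
          · have : j = 0 := by
              rw [Units.val_neg, Units.val_one] at hp
              omega
            subst this
            rw [hv, opSign, if_neg (by decide), map_smul, annihilation_fockPow_zero, smul_zero]

theorem vacuumMoment_eq_zero {f : H} (hf : ‖f‖ = 1) {n : ℕ} {ε : Fin (2 * n) → ℤˣ}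
    (hε : ε ∉ signPlus n) : vacuumMoment q ε (fun _ => f) = 0 := by
  change inner ℂ (vacuum H q) (signVector q f ε) = 0
  obtain ⟨h1, h2⟩ := signVector_eq q hf ε
  by_cases h : ∀ p, 0 ≤ ∑ i ∈ Finset.Ici p, (ε i : ℤ)
  · obtain ⟨c, j, hj, hv⟩ := h1 h
    have hj0 : j ≠ 0 := by
      rintro rfl
      exact hε ⟨by simpa using hj, h⟩
    rw [hv, inner_smul_right, inner_vacuum_fockPow, if_neg hj0, mul_zero]
  · push Not at h
    rw [h2 h, inner_zero_right]

/-! ### Summation over the sequences with a given last annihilator -/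

/-- The last `-1` of `ε` is followed by exactly `k` entries. -/
def LastNegAt {m : ℕ} (ε : Fin m → ℤˣ) (k : ℕ) : Prop :=
  ∃ i : Fin m, (i : ℕ) + 1 + k = m ∧ IsGreatest {j | ε j = -1} i

/-- Positions are counted from the right end, so a new left letter does not matter; the bound on k
keeps the last -1 from being that letter. -/
theorem lastNegAt_cons {m k : ℕ} (hk : k + 1 ≤ m) (s : ℤˣ) (ε : Fin m → ℤˣ) :
    LastNegAt (Fin.cons s ε : Fin (m + 1) → ℤˣ) k ↔ LastNegAt ε k := by
  constructor
  · rintro ⟨i, hi, h1, h2⟩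
    cases i using Fin.cases with
    | zero => simp at hi; omega
    | succ i =>
      refine ⟨i, by simp at hi; omega, by simpa using h1, fun j hj => ?_⟩
      exact Fin.succ_le_succ_iff.1 (h2 (a := j.succ) (by simpa using hj))
  · rintro ⟨i, hi, h1, h2⟩
    refine ⟨i.succ, by simp; omega, by simpa using h1, fun j hj => ?_⟩
    cases j using Fin.cases with
    | zero => exact Fin.zero_le _
    | succ j => exact Fin.succ_le_succ_iff.2 (h2 (by simpa using hj))

theorem lastNegAt_succ_self_iff {k : ℕ} (ε : Fin (k + 1) → ℤˣ) :
    LastNegAt ε k ↔ ε = Fin.cons (-1) (fun _ => 1) := by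
  constructor
  · rintro ⟨i, hi, h1, h2⟩
    obtain rfl : i = 0 := Fin.ext (by rw [Fin.val_zero]; omega)
    funext j
    cases j using Fin.cases with
    | zero => exact h1
    | succ j =>
      refine (Int.units_eq_one_or _).resolve_right fun hj => ?_
      exact absurd (h2 hj) (Fin.succ_pos j).not_ge
  · rintro rfl
    refine ⟨0, by simp [add_comm], rfl, fun j hj => ?_⟩
    cases j using Fin.cases with
    | zero => exact le_rfl
    | succ j => simp at hj

open Classical in
/-- The sum of the vectors of all sequences of length `m` whose last `-1` is followed by exactly
`k` entries. -/
def lastNegSum (f : H) (m k : ℕ) : Fock H q :=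
  ∑ ε : Fin m → ℤˣ with LastNegAt ε k, signVector q f ε

theorem lastNegSum_succ_self (f : H) (k : ℕ) :
    lastNegSum q f (k + 1) k = annihilation q f (fockPow q f k) := by
  simp only [lastNegSum, lastNegAt_succ_self_iff]
  rw [Finset.sum_filter, Finset.sum_ite_eq' Finset.univ, if_pos (Finset.mem_univ _),
    signVector_cons, signVector_const_one, opSign, if_neg (by decide)]

/-- The new left letter is unconstrained, so summing over its two signs applies A⁺ + A. -/
theorem lastNegSum_succ (f : H) {m k : ℕ} (hk : k + 1 ≤ m) :
    lastNegSum q f (m + 1) k = (creation q f + annihilation q f) (lastNegSum q f m k) := by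
  classical
  have hu : (Finset.univ : Finset ℤˣ) = {1, -1} := rfl
  rw [lastNegSum, Finset.sum_filter, ← (Fin.consEquiv fun _ => ℤˣ).sum_comp,
    Fintype.sum_prod_type, hu, Finset.sum_pair (by decide), lastNegSum,
    add_apply, map_sum, map_sum, Finset.sum_filter, Finset.sum_filter]
  have h (s : ℤˣ) (ε : Fin m → ℤˣ) :
      (if LastNegAt (Fin.consEquiv (fun _ => ℤˣ) (s, ε)) k then
        signVector q f (Fin.consEquiv (fun _ => ℤˣ) (s, ε)) else 0) =
      if LastNegAt ε k then opSign q s f (signVector q f ε) else 0 := by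
    change (if LastNegAt (Fin.cons s ε : Fin (m + 1) → ℤˣ) k then
      signVector q f (Fin.cons s ε : Fin (m + 1) → ℤˣ) else 0) = _
    simp only [lastNegAt_cons hk, signVector_cons]
  simp only [h]
  rfl

theorem lastNegSum_add (f : H) (m k : ℕ) :
    lastNegSum q f (k + 1 + m) k =
      ((creation q f + annihilation q f) ^ m) (annihilation q f (fockPow q f k)) := by
  induction m with
  | zero => rw [add_zero, lastNegSum_succ_self, pow_zero, one_apply_eq_self]
  | succ m ih =>
    rw [← add_assoc, lastNegSum_succ q f (by omega), ih, pow_succ']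
    rfl

/-- Removes the positivity and total-sum conditions, since sequences violating them have zero
moment. -/
theorem P_eq_inner_lastNegSum {f : H} (hf : ‖f‖ = 1) (n k : ℕ) :
    P q f n k = inner ℂ (vacuum H q) (lastNegSum q f (2 * n) k) := by
  classical
  rw [P, lastNegSum, inner_sum, Finset.sum_filter, Finset.sum_filter]
  refine Finset.sum_congr rfl fun ε _ => ?_
  by_cases h : ε ∈ signPlus n
  · have : ε ∈ signPlusLast n k ↔ LastNegAt ε k := ⟨fun h' => h'.2, fun h' => ⟨h, h'⟩⟩
    simp only [this]
    rfl
  · rw [if_neg fun h' => h h'.1]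
    split_ifs
    · exact (vacuumMoment_eq_zero q hf h).symm
    · rfl

/-! ### Weighted path counts -/

/-- The matrix element `⟨Φ, (A⁺(f) + A(f))^m f^{⊗j}⟩`. -/
def pathSum (f : H) (m j : ℕ) : ℂ :=
  inner ℂ (vacuum H q) (((creation q f + annihilation q f) ^ m) (fockPow q f j))

theorem pathSum_zero (f : H) (j : ℕ) : pathSum q f 0 j = if j = 0 then 1 else 0 :=
  inner_vacuum_fockPow q f j

theorem pathSum_succ_succ {f : H} (hf : ‖f‖ = 1) (m j : ℕ) :
    pathSum q f (m + 1) (j + 1) =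
      pathSum q f m (j + 2) + downWeight q (j + 1) * pathSum q f m j := by
  rw [pathSum, pow_succ, mul_apply_eq_comp, add_apply,
    creation_fockPow, annihilation_fockPow_succ q hf, map_add, map_smul, inner_add_right,
    inner_smul_right]
  rfl

/-- A path descends by at most one per step. -/
theorem pathSum_eq_zero {f : H} (hf : ‖f‖ = 1) {m j : ℕ} (h : m < j) : pathSum q f m j = 0 := by
  induction m generalizing j with
  | zero => rw [pathSum_zero, if_neg (by omega)]
  | succ m ih =>
    obtain _ | j := j
    · omega
    · rw [pathSum_succ_succ q hf, ih (by omega), ih (by omega), mul_zero, add_zero]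

theorem pathSum_self_succ {f : H} (hf : ‖f‖ = 1) (m : ℕ) :
    pathSum q f (m + 1) (m + 1) = downWeight q (m + 1) * pathSum q f m m := by
  rw [pathSum_succ_succ q hf, pathSum_eq_zero q hf (by omega), zero_add]

/-- Only the straight descent survives, and it steps down from height 2 exactly once. -/
theorem pathSum_self {f : H} (hf : ‖f‖ = 1) (m : ℕ) :
    pathSum q f (m + 2) (m + 2) = 1 + ((q : ℝ) : ℂ) := by
  induction m with
  | zero =>
    rw [pathSum_self_succ q hf, pathSum_self_succ q hf, pathSum_zero]
    simp [downWeight]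
  | succ m ih =>
    rw [pathSum_self_succ q hf, ih]
    simp [downWeight]

/-! ### From path counts to the recursion and the boundary values. -/

theorem P_eq_pathSum {f : H} (hf : ‖f‖ = 1) {n k m : ℕ} (h : 2 * n = k + 2 + m) :
    P q f n (k + 1) = downWeight q (k + 1) * pathSum q f m k := by
  rw [P_eq_inner_lastNegSum q hf, h, lastNegSum_add q f m (k + 1),
    annihilation_fockPow_succ q hf, map_smul, inner_smul_right]
  rfl

/-- Splitting the paths from height `k` to `0` by the length of their first ascent. -/
theorem pathSum_eq_sum_P {f : H} (hf : ‖f‖ = 1) {n k m : ℕ} (h1 : 1 ≤ k) (hk : k ≤ n + 1)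
    (hm : m + k = 2 * n) : pathSum q f m k = ∑ h ∈ Finset.Icc k n, P q f n h := by
  induction m generalizing k with
  | zero =>
    -- The hypotheses leave only n = 1, k = 2, where both sides vanish. The case k = n + 1 is
    -- admitted because the recursion raises k by one.
    rw [Finset.Icc_eq_empty (by omega), Finset.sum_empty, pathSum_eq_zero q hf (by omega)]
  | succ m ih =>
    obtain ⟨k, rfl⟩ : ∃ j, k = j + 1 := ⟨k - 1, by omega⟩
    obtain hkn | hkn := Nat.eq_or_lt_of_le hk
    · rw [Finset.Icc_eq_empty (by omega), Finset.sum_empty, pathSum_eq_zero q hf (by omega)]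
    · rw [pathSum_succ_succ q hf, ih (by omega) (by omega) (by omega),
        ← Finset.add_sum_Ioc_eq_sum_Icc (by omega : k + 1 ≤ n),
        P_eq_pathSum q hf (by omega : 2 * n = k + 2 + m), add_comm,
        ← Finset.Icc_succ_left_eq_Ioc]
      rfl

theorem P_succ_succ {f : H} (hf : ‖f‖ = 1) {n k : ℕ} (hk : 2 ≤ k) (hkn : k ≤ n) :
    P q f (n + 1) (k + 1) = ∑ h ∈ Finset.Icc k n, P q f n h := by
  rw [P_eq_pathSum q hf (m := 2 * n - k) (by omega),
    pathSum_eq_sum_P q hf (n := n) (by omega) (by omega) (by omega), downWeight,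
    if_neg (by omega), one_mul]

theorem P_self {f : H} (hf : ‖f‖ = 1) (n : ℕ) :
    P q f (n + 2) (n + 2) = 1 + ((q : ℝ) : ℂ) := by
  -- The weight of the first descent is absorbed as the first step of the straight path from height
  -- n + 2.
  rw [P_eq_pathSum q hf (m := n + 1) (by omega), ← pathSum_self_succ q hf, pathSum_self q hf]

end

end QTwoFock

theorem proposition4p4 {H : Type*} [NormedAddCommGroup H] [InnerProductSpace ℂ H]
    [CompleteSpace H] (q : Set.Icc (-1 : ℝ) 1) (f : H) (hf : ‖f‖ = 1) :
    (∀ n k : ℕ, 2 ≤ n → 2 ≤ k → k ≤ n →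
      QTwoFock.P q f (n + 1) (k + 1) = ∑ h ∈ Finset.Icc k n, QTwoFock.P q f n h) ∧
    (∀ n : ℕ, 1 ≤ n →
      QTwoFock.P q f (n + 1) (n + 1) = QTwoFock.P q f 2 2 ∧
      QTwoFock.P q f 2 2 = 1 + ((q : ℝ) : ℂ)) ∧
    -- the family `x n k = P (n + 1) (k + 1)` solves the system, with `x n n = 1 + q`
    (∀ x : ℕ → ℕ → ℂ, (∀ n k : ℕ, x n k = QTwoFock.P q f (n + 1) (k + 1)) →
      QTwoFock.IsCatalanTriangleSolution x ∧
      ∀ n : ℕ, 1 ≤ n → x n n = 1 + ((q : ℝ) : ℂ)) := by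
  have hself : ∀ n : ℕ, 1 ≤ n → QTwoFock.P q f (n + 1) (n + 1) = 1 + ((q : ℝ) : ℂ) := by
    intro n hn
    obtain ⟨n, rfl⟩ := Nat.exists_eq_add_of_le' hn
    exact QTwoFock.P_self q hf n
  refine ⟨fun n k _ hk hkn => QTwoFock.P_succ_succ q hf hk hkn,
    fun n hn => ⟨(hself n hn).trans (hself 1 le_rfl).symm, hself 1 le_rfl⟩,
    fun x hx => ⟨fun n k hk hkn => ?_, fun n hn => (hx n n).trans (hself n hn)⟩⟩
  -- The index shift turns 1 ≤ k into 2 ≤ k + 1, the range in which the recursion for P holds.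
  rw [hx, QTwoFock.P_succ_succ q hf (by omega) (by omega), ← Finset.map_add_right_Icc,
    Finset.sum_map]
  exact Finset.sum_congr rfl fun j _ => (hx n j).symm
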